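/- Let $N\ge 3$ be odd and let $|\psi_g\rangle$ be the 1D graph state on an open chain of $N$ qubits, i.e. the unit vector (unique up to a phase) stabilized by $X_1Z_2$, by $Z_{i-1}X_iZ_{i+1}$ for $2\le i\le N-1$, and by $Z_{N-1}X_N$. For $\epsilon>0$ and $T\ge 1$ consider the following algorithm, which is given $3T$ independent copies of an unknown $N$-qubit state $\rho$. 1. Measure every qubit of $T$ copies along $X$, of $T$ further copies along $(X+Z)/\sqrt2$, and of the remaining $T$ copies along $(X-Z)/\sqrt2$; let $b_x^{i,t},\,b_{+}^{i,t},\,b_{-}^{i,t}\in\{\pm1\}$ be the outcomes for qubit $i$ in the $t$-th measurement along the respective direction. 2. Compute $\widehat U=\frac1T\sum_{t=1}^T\prod_{i\ \mathrm{odd}}b_x^{i,t}$. If $\widehat U<1-13\epsilon/4$, output FAILED and stop. 3. Compute $$\widehat M_i=\frac1T\sum_{t=1}^T\Big[\sqrt2\big(b_+^{i-1,t}b_+^{i,t}b_+^{i+1,t}+b_-^{i-1,t}b_-^{i,t}b_-^{i+1,t}\big)-b_x^{i-1,t}b_x^{i,t}b_x^{i+1,t}\Big]\quad(2\le i\le N-1),$$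 $$\widehat M_1=\frac1T\sum_{t=1}^T\big[b_+^{1,t}b_+^{2,t}-b_-^{1,t}b_-^{2,t}\big],\qquad \widehat M_N=\frac1T\sum_{t=1}^T\big[b_+^{N-1,t}b_+^{N,t}-b_-^{N-1,t}b_-^{N,t}\big].$$ If $\widehat M_i>1-9\sqrt\epsilon$ for all $1\le i\le N$, output CERTIFIED; otherwise output FAILED. There is a universal constant $C>0$ such that for every odd $N\ge3$ and every $0<\epsilon<1/(64N^2)$ there is a number $T_0\le C/\epsilon^2$ such that for every $T\ge T_0$ and every $N$-qubit state $\rho$: * if $\langle\psi_g|\rho|\psi_g\rangle>1-\epsilon$, then the algorithm outputs CERTIFIED with probability at least $2/3$; * if $\langle\psi_g|\rho|\psi_g\rangle<1-8N\sqrt\epsilon$, then the algorithm outputs FAILED with probability at least $2/3$. -/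

import Mathlib

open scoped BigOperators ComplexOrder

noncomputable section

namespace UniformCertification

/-- Matrices acting on `N` qubits, in the computational basis indexed by `Fin N → Fin 2`. -/
abbrev QubitOp (N : ℕ) : Type := Matrix (Fin N → Fin 2) (Fin N → Fin 2) ℂ

/-- Vectors of the `N`-qubit Hilbert space `(ℂ²)^{⊗ N}` in the computational basis. -/
abbrev QubitVec (N : ℕ) : Type := (Fin N → Fin 2) → ℂ

def pauliX : Matrix (Fin 2) (Fin 2) ℂ := !![0, 1; 1, 0]

def pauliZ : Matrix (Fin 2) (Fin 2) ℂ := !![1, 0; 0, -1]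

/-- The tensor product `A₁ ⊗ ⋯ ⊗ A_N` of single-qubit operators. -/
def tensorOp {N : ℕ} (A : Fin N → Matrix (Fin 2) (Fin 2) ℂ) : QubitOp N :=
  Matrix.of fun s t => ∏ i, A i (s i) (t i)

/-- Quantum states: positive semidefinite matrices of trace one. -/
structure IsDensityMatrix {N : ℕ} (ρ : QubitOp N) : Prop where
  posSemidef : ρ.PosSemidef
  trace_eq_one : ρ.trace = 1

/-- The fidelity `⟨ψ|ρ|ψ⟩`. -/
def fidelity {N : ℕ} (ψ : QubitVec N) (ρ : QubitOp N) : ℝ :=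
  (star ψ ⬝ᵥ (ρ.mulVec ψ)).re

/-- The stabilizer generator of the open chain at site `i`: `X` at `i` and `Z` at each of the
sites `i - 1`, `i + 1` that belongs to the chain. -/
def chainStabilizer {N : ℕ} (i : Fin N) : QubitOp N :=
  tensorOp fun j =>
    if j = i then pauliX
    else if j.val + 1 = i.val ∨ i.val + 1 = j.val then pauliZ
    else 1

/-- `ψ` is the 1D graph state on the open chain of `N` qubits: the unit vector (unique up to a
phase) fixed by all stabilizer generators. -/
structure IsChainGraphState {N : ℕ} (ψ : QubitVec N) : Prop where
  unit : star ψ ⬝ᵥ ψ = 1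
  stabilized : ∀ i : Fin N, (chainStabilizer i).mulVec ψ = ψ

/-- The three directions `x`, `(x + z)/√2` and `(x - z)/√2`. -/
inductive Direction : Type
  | x
  | xzPlus
  | xzMinus
  deriving DecidableEq

instance : Fintype Direction where
  elems := {.x, .xzPlus, .xzMinus}
  complete := by rintro (_ | _ | _) <;> decide

/-- The single-qubit observable of a direction; its eigenvalues are `1` and `-1`. -/
def Direction.observable : Direction → Matrix (Fin 2) (Fin 2) ℂ
  | .x => pauliX
  | .xzPlus => ((Real.sqrt 2 : ℝ) : ℂ)⁻¹ • (pauliX + pauliZ)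
  | .xzMinus => ((Real.sqrt 2 : ℝ) : ℂ)⁻¹ • (pauliX - pauliZ)

/-- The projector `(1 + s A)/2` onto the eigenspace of the observable `A` for the outcome
`s = ±1`. -/
def Direction.projector (d : Direction) (s : ℤˣ) : Matrix (Fin 2) (Fin 2) ℂ :=
  (1 / 2 : ℂ) • (1 + ((s : ℤ) : ℂ) • d.observable)

/-- Born probability of the outcomes `b` when every qubit of `ρ` is measured along `d`. -/
def bornProb {N : ℕ} (ρ : QubitOp N) (d : Direction) (b : Fin N → ℤˣ) : ℝ :=
  (ρ * tensorOp fun i => d.projector (b i)).trace.re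

/-- The law of the outcomes of one uniform measurement of `ρ` along `d`. -/
def outcomeLaw {N : ℕ} (ρ : QubitOp N) (d : Direction) : MeasureTheory.Measure (Fin N → ℤˣ) :=
  ∑ b : Fin N → ℤˣ, ENNReal.ofReal (bornProb ρ d b) • MeasureTheory.Measure.dirac b

/-- The outcome of qubit `i` in the `t`-th measurement along `d` is `data (d, t) i`. -/
abbrev Data (N T : ℕ) : Type := Direction × Fin T → Fin N → ℤˣ

/-- The joint law of all outcomes: `3T` copies of `ρ` are measured independently, `T` of them
along each direction. -/
def dataLaw {N : ℕ} (ρ : QubitOp N) (T : ℕ) : MeasureTheory.Measure (Data N T) :=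
  MeasureTheory.Measure.pi fun k => outcomeLaw ρ k.1

/-- The product over `I` of the outcomes of one measurement event. -/
def correlator {N : ℕ} (b : Fin N → ℤˣ) (I : Finset (Fin N)) : ℝ :=
  ∏ i ∈ I, (((b i : ℤˣ) : ℤ) : ℝ)

/-- The odd sites `1, 3, 5, …`; site `k` of the chain has the index `k - 1` in `Fin N`. -/
def oddSites (N : ℕ) : Finset (Fin N) :=
  Finset.univ.filter fun i => Even i.val

/-- The sites `i - 1`, `i`, `i + 1`, as far as they belong to the chain. -/
def closedNbhd {N : ℕ} (i : Fin N) : Finset (Fin N) :=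
  Finset.univ.filter fun j => j.val ≤ i.val + 1 ∧ i.val ≤ j.val + 1

/-- Empirical average of `U_X`, the product of `X` over the odd sites. -/
def empU {N T : ℕ} (data : Data N T) : ℝ :=
  (1 / (T : ℝ)) * ∑ t : Fin T, correlator (data (.x, t)) (oddSites N)

/-- Empirical average of `M_i`; the first case is that of the two ends of the chain. -/
def empM {N T : ℕ} (data : Data N T) (i : Fin N) : ℝ :=
  if i.val = 0 ∨ i.val + 1 = N then
    (1 / (T : ℝ)) * ∑ t : Fin T,
      (correlator (data (.xzPlus, t)) (closedNbhd i)
        - correlator (data (.xzMinus, t)) (closedNbhd i))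
  else
    (1 / (T : ℝ)) * ∑ t : Fin T,
      (Real.sqrt 2 * (correlator (data (.xzPlus, t)) (closedNbhd i)
          + correlator (data (.xzMinus, t)) (closedNbhd i))
        - correlator (data (.x, t)) (closedNbhd i))

inductive Verdict : Type
  | certified
  | failed

open Classical in
/-- The certification algorithm, as a function of the precision and the measurement outcomes. -/
def certify {N T : ℕ} (ε : ℝ) (data : Data N T) : Verdict :=
  if empU data < 1 - 13 * ε / 4 then .failed
  else if ∀ i : Fin N, empM data i > 1 - 9 * Real.sqrt ε then .certified
  else .failed

/-- The probability that the algorithm, run on `3T` copies of `ρ`, outputs `v`. -/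
def verdictProb {N : ℕ} (ρ : QubitOp N) (T : ℕ) (ε : ℝ) (v : Verdict) : ℝ :=
  (dataLaw ρ T).real {data | certify ε data = v}

end UniformCertification

end

/-! Measuring all qubits along (X ± Z)/√2 and combining the correlators as in the estimators yields,
on average, the stabilizer `Sᵢ` plus unwanted Pauli strings: ZX at an end, XZZ and ZZX inside
(`twoSite_observable`, `threeSite_observable`). Each unwanted string carries exactly one Z on the
odd sites, so it anticommutes with U, the product of X over those sites. The uncertainty relation
`expval_sq_add_sq_le_one` then bounds its mean by √(1 - ⟨U⟩²), which is O(√ε) once ⟨U⟩ is within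
O(ε) of 1.

For N odd, U fixes the graph state (`oddX_mulVec`). High fidelity therefore makes ⟨U⟩ and every ⟨Sᵢ⟩
close to 1. Conversely, if ⟨U⟩ is noticeably below 1, the test of U fails. Otherwise the estimators
are faithful up to O(√ε), and the union bound `one_sub_fidelity_le` turns low fidelity into one
visibly violated stabilizer.

Sampling errors are handled by Chebyshev's inequality. Precision of order ε for U costs T of order
1/ε². The estimators of the stabilizers need only precision √ε, and their number N is absorbed
because Nε is small. -/

namespace UniformCertification

open Matrix

/-! ### Tensor products of reflections and expectation values -/

section TensorAlgebra

variable {N : ℕ}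

theorem tensorOp_apply (A : Fin N → Matrix (Fin 2) (Fin 2) ℂ) (s t : Fin N → Fin 2) :
    tensorOp A s t = ∏ i, A i (s i) (t i) := rfl

theorem tensorOp_mul (A B : Fin N → Matrix (Fin 2) (Fin 2) ℂ) :
    tensorOp A * tensorOp B = tensorOp fun i => A i * B i := by
  ext s t
  simp only [Matrix.mul_apply, tensorOp_apply, ← Finset.prod_mul_distrib]
  rw [Finset.prod_univ_sum]
  simp

theorem tensorOp_one : tensorOp (fun _ : Fin N => (1 : Matrix (Fin 2) (Fin 2) ℂ)) = 1 := by
  ext s t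
  simp only [tensorOp_apply, Matrix.one_apply, Finset.prod_ite_zero, Finset.prod_const_one,
    Finset.mem_univ, true_implies, funext_iff]

theorem tensorOp_conjTranspose (A : Fin N → Matrix (Fin 2) (Fin 2) ℂ) :
    (tensorOp A)ᴴ = tensorOp fun i => (A i)ᴴ := by
  ext s t
  simp [tensorOp_apply, Matrix.conjTranspose_apply]

theorem tensorOp_smul (c : Fin N → ℂ) (A : Fin N → Matrix (Fin 2) (Fin 2) ℂ) :
    (tensorOp fun i => c i • A i) = (∏ i, c i) • tensorOp A := by
  ext s t
  simp [tensorOp_apply, Finset.prod_mul_distrib]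

/-- Tensor factors that commute up to scalars yield operators that commute up to the product of
the scalars. -/
theorem tensorOp_mul_comm {A B : Fin N → Matrix (Fin 2) (Fin 2) ℂ} (c : Fin N → ℂ)
    (h : ∀ i, A i * B i = c i • (B i * A i)) :
    tensorOp A * tensorOp B = (∏ i, c i) • (tensorOp B * tensorOp A) := by
  simp only [tensorOp_mul, h, tensorOp_smul]

/-- Hermitian involutions, such as the Pauli strings. -/
structure IsReflection {n : Type*} [Fintype n] [DecidableEq n] (A : Matrix n n ℂ) : Prop where
  herm : Aᴴ = A
  sq : A * A = 1

theorem isReflection_one {n : Type*} [Fintype n] [DecidableEq n] :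
    IsReflection (1 : Matrix n n ℂ) := ⟨by simp, by simp⟩

theorem isReflection_pauliX : IsReflection pauliX := by
  constructor <;> ext i j <;> fin_cases i <;> fin_cases j <;>
    simp [pauliX, Matrix.mul_apply, Fin.sum_univ_two]

theorem isReflection_pauliZ : IsReflection pauliZ := by
  constructor <;> ext i j <;> fin_cases i <;> fin_cases j <;>
    simp [pauliZ, Matrix.mul_apply, Fin.sum_univ_two]

theorem pauliX_mul_pauliZ : pauliX * pauliZ = -(pauliZ * pauliX) := by
  ext i j
  fin_cases i <;> fin_cases j <;> simp [pauliX, pauliZ, Matrix.mul_apply, Fin.sum_univ_two]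

theorem IsReflection.tensorOp {A : Fin N → Matrix (Fin 2) (Fin 2) ℂ}
    (h : ∀ i, IsReflection (A i)) : IsReflection (tensorOp A) := by
  constructor
  · simp only [tensorOp_conjTranspose, (h _).herm]
  · simp only [tensorOp_mul, (h _).sq, tensorOp_one]

theorem sqrt_two_inv_sq : (((Real.sqrt 2 : ℝ) : ℂ)⁻¹) * ((Real.sqrt 2 : ℝ) : ℂ)⁻¹ = 1 / 2 := by
  rw [← mul_inv, ← Complex.ofReal_mul, Real.mul_self_sqrt (by norm_num)]
  norm_num

theorem Direction.isReflection_observable (d : Direction) : IsReflection d.observable := by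
  have hX := isReflection_pauliX
  have hZ := isReflection_pauliZ
  cases d with
  | x => exact hX
  | xzPlus =>
    constructor
    · simp [Direction.observable, conjTranspose_smul, hX.herm, hZ.herm]
    · simp only [Direction.observable, smul_mul_smul_comm, sqrt_two_inv_sq, add_mul, mul_add,
        hX.sq, hZ.sq, pauliX_mul_pauliZ]
      module
  | xzMinus =>
    constructor
    · simp [Direction.observable, conjTranspose_smul, hX.herm, hZ.herm]
    · simp only [Direction.observable, smul_mul_smul_comm, sqrt_two_inv_sq, sub_mul, mul_sub,
        hX.sq, hZ.sq, pauliX_mul_pauliZ]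
      module

theorem Direction.projector_conjTranspose (d : Direction) (s : ℤˣ) :
    (d.projector s)ᴴ = d.projector s := by
  simp [Direction.projector, conjTranspose_smul, d.isReflection_observable.herm]

theorem Direction.projector_mul_self (d : Direction) (s : ℤˣ) :
    d.projector s * d.projector s = d.projector s := by
  rcases Int.units_eq_one_or s with rfl | rfl <;>
    simp only [Direction.projector, mul_add, add_mul, one_mul, mul_one, smul_mul_assoc,
      mul_smul_comm, d.isReflection_observable.sq, smul_smul] <;>
    push_cast <;> module

/-- The expectation value of the observable `A` in the state `ρ`. -/
noncomputable def expval (ρ A : QubitOp N) : ℝ := (ρ * A).trace.re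

theorem expval_add (ρ A B : QubitOp N) : expval ρ (A + B) = expval ρ A + expval ρ B := by
  simp [expval, mul_add]

theorem expval_sub (ρ A B : QubitOp N) : expval ρ (A - B) = expval ρ A - expval ρ B := by
  simp [expval, mul_sub]

theorem expval_smul (ρ A : QubitOp N) (c : ℝ) : expval ρ ((c : ℂ) • A) = c * expval ρ A := by
  simp [expval]

theorem expval_sum {ι : Type*} (s : Finset ι) (ρ : QubitOp N) (A : ι → QubitOp N) :
    expval ρ (∑ i ∈ s, A i) = ∑ i ∈ s, expval ρ (A i) := by
  simp [expval, Finset.mul_sum, Matrix.trace_sum]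

theorem IsDensityMatrix.expval_one {ρ : QubitOp N} (h : IsDensityMatrix ρ) : expval ρ 1 = 1 := by
  simp [expval, h.trace_eq_one]

/-- Cyclicity of the trace moves one factor to the left of `ρ`. For a Hermitian projection the
square disappears, and this is how operator inequalities enter below. -/
theorem IsDensityMatrix.expval_mul_self_nonneg {ρ : QubitOp N} (h : IsDensityMatrix ρ)
    {A : QubitOp N} (hA : Aᴴ = A) : 0 ≤ expval ρ (A * A) := by
  have := (h.posSemidef.mul_mul_conjTranspose_same A).trace_nonneg
  rw [hA, Matrix.trace_mul_cycle, Matrix.mul_assoc, Matrix.trace_mul_comm,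
    Matrix.mul_assoc, Matrix.trace_mul_comm, Matrix.mul_assoc] at this
  exact (Complex.le_def.1 this).1

/-- Anticommuting reflections obey the uncertainty relation `⟨A⟩² + ⟨B⟩² ≤ 1`. -/
theorem IsDensityMatrix.expval_sq_add_sq_le_one {ρ : QubitOp N} (h : IsDensityMatrix ρ)
    {A B : QubitOp N} (hA : IsReflection A) (hB : IsReflection B) (hAB : A * B = -(B * A)) :
    expval ρ A ^ 2 + expval ρ B ^ 2 ≤ 1 := by
  set a := expval ρ A with ha
  set b := expval ρ B with hb
  set r := a ^ 2 + b ^ 2 with hr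
  -- Anticommutation gives (aA + bB)² = r, so the square of r - (aA + bB) has mean r² + r - 2r² =
  -- r(1 - r); its nonnegativity forces r ≤ 1.
  have hherm : ((r : ℂ) • (1 : QubitOp N) - ((a : ℂ) • A + (b : ℂ) • B))ᴴ
      = (r : ℂ) • (1 : QubitOp N) - ((a : ℂ) • A + (b : ℂ) • B) := by
    simp [conjTranspose_smul, hA.herm, hB.herm]
  have hpos := h.expval_mul_self_nonneg hherm
  have hexp : ((r : ℂ) • (1 : QubitOp N) - ((a : ℂ) • A + (b : ℂ) • B)) *
      ((r : ℂ) • (1 : QubitOp N) - ((a : ℂ) • A + (b : ℂ) • B)) =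
      ((r ^ 2 + r : ℝ) : ℂ) • (1 : QubitOp N) - ((2 * r * a : ℝ) : ℂ) • A
        - ((2 * r * b : ℝ) : ℂ) • B := by
    simp only [sub_mul, mul_sub, add_mul, mul_add, smul_mul_smul_comm, hA.sq, hB.sq, one_mul,
      mul_one, hAB, hr]
    push_cast
    module
  rw [hexp, expval_sub, expval_sub, expval_smul, expval_smul, expval_smul, h.expval_one,
    ← ha, ← hb] at hpos
  by_contra hlt
  push Not at hlt
  nlinarith

theorem expval_vecMulVec (ψ : QubitVec N) (ρ : QubitOp N) :
    expval ρ (vecMulVec ψ (star ψ)) = fidelity ψ ρ := by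
  rw [expval, fidelity, Matrix.mul_vecMulVec, Matrix.trace_vecMulVec, dotProduct_comm]

/-- A reflection that fixes `ψ` has expectation close to one in states close to `ψ`. -/
theorem IsDensityMatrix.le_expval_of_mulVec_eq {ρ : QubitOp N} (h : IsDensityMatrix ρ)
    {ψ : QubitVec N} (hψ : star ψ ⬝ᵥ ψ = 1) {V : QubitOp N} (hV : IsReflection V)
    (hVψ : V *ᵥ ψ = ψ) : 2 * fidelity ψ ρ - 1 ≤ expval ρ V := by
  set K : QubitOp N := vecMulVec ψ (star ψ) with hK
  have hKh : Kᴴ = K := by simp [hK, conjTranspose_vecMulVec]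
  have hKK : K * K = K := by
    simp [hK, vecMulVec_mul_vecMulVec, hψ]
  have hVK : V * K = K := by simp [hK, mul_vecMulVec, hVψ]
  have hKV : K * V = K := by
    have := congrArg conjTranspose hVK
    rwa [conjTranspose_mul, hKh, hV.herm] at this
  -- The projection onto the part of the +1 eigenspace of `V` orthogonal to `ψ`.
  set P : QubitOp N := (1 / 2 : ℂ) • (1 + V) - K with hP
  have hPh : Pᴴ = P := by simp [hP, hKh, conjTranspose_smul, hV.herm]
  have hPP : P * P = P := by
    simp only [hP, sub_mul, mul_sub, smul_mul_assoc, mul_smul_comm, add_mul, mul_add, one_mul,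
      mul_one, hV.sq, hKK, hVK, hKV]
    module
  have h0 := h.expval_mul_self_nonneg hPh
  have h2 : (1 / 2 : ℂ) = ((1 / 2 : ℝ) : ℂ) := by norm_num
  rw [hPP, hP, h2, expval_sub, expval_smul, expval_add, h.expval_one, expval_vecMulVec] at h0
  linarith

end TensorAlgebra

/-! ### The graph state, its stabilizers and the product of X over the odd sites -/

section GraphState

variable {N : ℕ}

theorem isReflection_chainStabilizer (i : Fin N) : IsReflection (chainStabilizer i) := by
  refine IsReflection.tensorOp fun j => ?_
  split_ifs
  exacts [isReflection_pauliX, isReflection_pauliZ, isReflection_one]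

/-- For adjacent sites X meets Z twice, at `i` and at `j`, and the two signs cancel; otherwise no
sign arises. -/
theorem chainStabilizer_comm (i j : Fin N) :
    chainStabilizer i * chainStabilizer j = chainStabilizer j * chainStabilizer i := by
  by_cases hij : i = j
  · rw [hij]
  have key := tensorOp_mul_comm
    (A := fun k : Fin N => if k = i then pauliX
      else if k.val + 1 = i.val ∨ i.val + 1 = k.val then pauliZ else 1)
    (B := fun k : Fin N => if k = j then pauliX
      else if k.val + 1 = j.val ∨ j.val + 1 = k.val then pauliZ else 1)
    (fun k => (if k = i then (if i.val + 1 = j.val ∨ j.val + 1 = i.val then -1 else 1) else 1)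
      * (if k = j then (if i.val + 1 = j.val ∨ j.val + 1 = i.val then -1 else 1) else 1))
    (by
      intro k
      by_cases hi : k = i
      · subst hi
        by_cases h : k.val + 1 = j.val ∨ j.val + 1 = k.val
        · simp [hij, h, pauliX_mul_pauliZ]
        · simp [hij, h]
      · by_cases hj : k = j
        · subst hj
          by_cases h : i.val + 1 = k.val ∨ k.val + 1 = i.val
          · simp [hi, h, or_comm.1 h, pauliX_mul_pauliZ]
          · have h' : ¬ (k.val + 1 = i.val ∨ i.val + 1 = k.val) := fun hh => h hh.symm
            simp [hi, h, h']
        · simp only [hi, hj, if_false]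
          split_ifs <;> simp)
  rw [chainStabilizer, chainStabilizer, key, Finset.prod_mul_distrib, Finset.prod_ite_eq',
    Finset.prod_ite_eq']
  split_ifs <;> simp_all

/-- Entries of an operator string whose only non-diagonal factor is an `X` at site `i`. -/
theorem tensorOp_apply_eq_zero {A : Fin N → Matrix (Fin 2) (Fin 2) ℂ} {i : Fin N}
    (hi : A i = pauliX) (hA : ∀ j, j ≠ i → (A j).IsDiag) {s t : Fin N → Fin 2}
    (hst : t ≠ Function.update s i (1 - s i)) : tensorOp A s t = 0 := by
  obtain ⟨j, hj⟩ := Function.ne_iff.1 hst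
  rw [tensorOp_apply]
  apply Finset.prod_eq_zero (Finset.mem_univ j)
  by_cases hji : j = i
  · subst hji
    rw [Function.update_self] at hj
    rw [hi]
    generalize s j = a at hj ⊢
    generalize t j = b at hj ⊢
    fin_cases a <;> fin_cases b <;> simp_all [pauliX]
  · rw [Function.update_of_ne hji] at hj
    exact hA j hji fun h => hj h.symm

/-- The generator is a signed flip of bit `i`: only one entry of each row can be nonzero. -/
theorem chainStabilizer_mulVec_apply (i : Fin N) (φ : QubitVec N) (s : Fin N → Fin 2) :
    (chainStabilizer i *ᵥ φ) s = chainStabilizer i s (Function.update s i (1 - s i)) *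
      φ (Function.update s i (1 - s i)) := by
  rw [Matrix.mulVec, dotProduct]
  apply Finset.sum_eq_single_of_mem _ (Finset.mem_univ _)
  intro t _ ht
  rw [chainStabilizer, tensorOp_apply_eq_zero (i := i) (by simp) _ ht, zero_mul]
  intro j hj
  simp only [hj, if_false]
  split_ifs
  · intro a b hab
    fin_cases a <;> fin_cases b <;> simp_all [pauliZ]
  · exact isDiag_one

/-- A vector fixed by all stabilizer generators is determined by its entry at `0`. -/
theorem eq_zero_of_stabilized {φ : QubitVec N} (h : ∀ i : Fin N, chainStabilizer i *ᵥ φ = φ)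
    (h0 : φ 0 = 0) : φ = 0 := by
  -- Induction on a set containing the support of `s`: the generator at `i` ties the entry at `s` to
  -- the entry with bit `i` cleared.
  have key : ∀ (F : Finset (Fin N)) (s : Fin N → Fin 2), (∀ j, j ∉ F → s j = 0) → φ s = 0 := by
    intro F
    induction F using Finset.induction_on with
    | empty =>
      intro s hs
      rw [show s = 0 from funext fun j => hs j (by simp), h0]
    | insert i F hi ih =>
      intro s hs
      by_cases hsi : s i = 0
      · refine ih s fun j hj => ?_
        by_cases hji : j = i
        · rw [hji, hsi]
        · exact hs j (by simp [hji, hj])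
      · rw [← h i, chainStabilizer_mulVec_apply, ih, mul_zero]
        intro j hj
        by_cases hji : j = i
        · subst hji
          rw [Function.update_self]
          generalize s j = a at hsi ⊢
          fin_cases a <;> simp_all
        · rw [Function.update_of_ne hji]
          exact hs j (by simp [hji, hj])
  exact funext fun s => key Finset.univ s (by simp)

theorem IsChainGraphState.apply_zero_ne {ψ : QubitVec N} (hψ : IsChainGraphState ψ) :
    ψ 0 ≠ 0 := by
  intro h
  have := hψ.unit
  rw [eq_zero_of_stabilized hψ.stabilized h] at this
  simp at this

/-- The graph state is unique up to a scalar. -/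
theorem IsChainGraphState.eq_smul_of_stabilized {ψ φ : QubitVec N} (hψ : IsChainGraphState ψ)
    (h : ∀ i : Fin N, chainStabilizer i *ᵥ φ = φ) : φ = (φ 0 / ψ 0) • ψ := by
  have := eq_zero_of_stabilized (φ := φ - (φ 0 / ψ 0) • ψ)
    (fun i => by rw [mulVec_sub, mulVec_smul, h, hψ.stabilized])
    (by simp [div_mul_cancel₀ _ hψ.apply_zero_ne])
  exact sub_eq_zero.1 this

/-- The union bound for the commuting projections `(1 + Sᵢ)/2`. -/
theorem exists_projection_of_chainStabilizer {ρ : QubitOp N} (hρ : IsDensityMatrix ρ)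
    {ψ : QubitVec N} (hψ : IsChainGraphState ψ) (F : Finset (Fin N)) :
    ∃ R : QubitOp N, Rᴴ = R ∧ R * R = R ∧ R *ᵥ ψ = ψ ∧
      (∀ j, chainStabilizer j * R = R * chainStabilizer j) ∧
      (∀ i ∈ F, chainStabilizer i * R = R) ∧
      1 - expval ρ R ≤ ∑ i ∈ F, (1 - expval ρ (chainStabilizer i)) / 2 := by
  induction F using Finset.induction_on with
  | empty => exact ⟨1, by simp, by simp, by simp, by simp, by simp, by simp [hρ.expval_one]⟩
  | insert i F hi ih =>
    obtain ⟨R, hRh, hRR, hRψ, hcomm, hfix, hle⟩ := ih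
    have hS := isReflection_chainStabilizer i
    set S := chainStabilizer i with hSdef
    have hSR : S * R = R * S := hcomm i
    have hRSR : R * S * R = R * S := by rw [← hSR, mul_assoc, hRR]
    have hRSS : R * S * S = R := by rw [mul_assoc, hS.sq, mul_one]
    have hRRS : R * (R * S) = R * S := by rw [← mul_assoc, hRR]
    have hSRS : S * (R * S) = R := by rw [← hSR, ← mul_assoc, hS.sq, one_mul]
    -- The new projection is R(1 + S)/2.
    refine ⟨(1 / 2 : ℂ) • (R + R * S), ?_, ?_, ?_, ?_, ?_, ?_⟩
    · simp [conjTranspose_smul, hRh, hS.herm, hSR]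
    · simp only [smul_mul_assoc, mul_smul_comm, add_mul, mul_add, hRR, hRRS, hRSR]
      rw [mul_assoc R S, hSRS, hRR]
      module
    · rw [smul_mulVec, add_mulVec, ← mulVec_mulVec, hψ.stabilized, hRψ]
      module
    · intro j
      rw [mul_smul_comm, smul_mul_assoc, mul_add, add_mul, ← mul_assoc, hcomm j, mul_assoc,
        mul_assoc, hSdef, chainStabilizer_comm j i]
    · intro j hj
      rcases Finset.mem_insert.1 hj with rfl | hj
      · rw [mul_smul_comm, mul_add, hSRS, hSR, add_comm]
      · rw [mul_smul_comm, mul_add, ← mul_assoc, hfix j hj]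
    · rw [Finset.sum_insert hi]
      have h2 : (1 / 2 : ℂ) = ((1 / 2 : ℝ) : ℂ) := by norm_num
      -- `Q` = (1 - R)(1 - S)/2 is exactly the slack in the union bound for the two complementary
      -- projections.
      set Q : QubitOp N := (1 / 2 : ℂ) • (1 - S - R + R * S) with hQ
      have hQh : Qᴴ = Q := by simp [hQ, conjTranspose_smul, hRh, hS.herm, hSR]
      have hQQ : Q * Q = Q := by
        simp only [hQ, smul_mul_assoc, mul_smul_comm, add_mul, mul_add, sub_mul, mul_sub, one_mul,
          mul_one, hRR, hRRS, hRSR, hS.sq, hSR, hRSS, hSRS]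
        rw [mul_assoc R S, hSRS, hRR]
        module
      have h0 := hρ.expval_mul_self_nonneg hQh
      rw [hQQ, hQ, h2, expval_smul, expval_add, expval_sub, expval_sub, hρ.expval_one] at h0
      rw [h2, expval_smul, expval_add]
      linarith

/-- With all generators included, the range of `R` consists of stabilized vectors, hence of
multiples of `ψ`. As `R` is Hermitian and fixes `ψ`, it is the rank-one projection onto `ψ`. -/
theorem one_sub_fidelity_le {ρ : QubitOp N} (hρ : IsDensityMatrix ρ)
    {ψ : QubitVec N} (hψ : IsChainGraphState ψ) :
    1 - fidelity ψ ρ ≤ ∑ i, (1 - expval ρ (chainStabilizer i)) / 2 := by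
  obtain ⟨R, hRh, -, hRψ, -, hfix, hle⟩ :=
    exists_projection_of_chainStabilizer hρ hψ Finset.univ
  have hR : R = vecMulVec ψ (star ψ) := by
    apply Matrix.ext_of_mulVec_single
    intro s
    set e : QubitVec N := Pi.single s 1
    have h1 := hψ.eq_smul_of_stabilized (φ := R *ᵥ e)
      fun i => by rw [mulVec_mulVec, hfix i (Finset.mem_univ i)]
    set c := (R *ᵥ e) 0 / ψ 0
    have h2 : star ψ ⬝ᵥ (R *ᵥ e) = star ψ ⬝ᵥ e := by
      rw [dotProduct_mulVec, ← hRh, ← star_mulVec, hRψ]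
    rw [h1, dotProduct_smul, hψ.unit, smul_eq_mul, mul_one] at h2
    rw [h1, vecMulVec_mulVec, h2]
    ext; simp [mul_comm]
  rwa [hR, expval_vecMulVec] at hle

/-- The product of `X` over the odd sites. -/
noncomputable def oddX (N : ℕ) : QubitOp N :=
  tensorOp fun j => if j ∈ oddSites N then pauliX else 1

theorem isReflection_oddX : IsReflection (oddX N) := by
  refine IsReflection.tensorOp fun j => ?_
  split_ifs
  exacts [isReflection_pauliX, isReflection_one]

theorem mem_oddSites {j : Fin N} : j ∈ oddSites N ↔ Even j.val := by simp [oddSites]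

/-- Signs come from neighbours of `i` on odd sites. There are none if `i` is itself odd; if it is
even, `N` odd guarantees that both neighbours exist, and the two signs cancel. -/
theorem chainStabilizer_mul_oddX (hN : Odd N) (i : Fin N) :
    chainStabilizer i * oddX N = oddX N * chainStabilizer i := by
  have key := tensorOp_mul_comm
    (A := fun k : Fin N => if k = i then pauliX
      else if k.val + 1 = i.val ∨ i.val + 1 = k.val then pauliZ else 1)
    (B := fun k : Fin N => if k ∈ oddSites N then pauliX else 1)
    (fun k => if Even k.val ∧ (k.val + 1 = i.val ∨ i.val + 1 = k.val) then -1 else 1)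
    (by
      intro k
      simp only [mem_oddSites]
      by_cases hi : k = i
      · subst hi
        by_cases h : Even k.val <;> simp [h]
      · by_cases h : Even k.val <;>
          by_cases h' : k.val + 1 = i.val ∨ i.val + 1 = k.val <;>
          simp [h, h', hi, pauliX_mul_pauliZ])
  rw [chainStabilizer, oddX, key]
  suffices h : (∏ k : Fin N,
      if Even k.val ∧ (k.val + 1 = i.val ∨ i.val + 1 = k.val) then (-1 : ℂ) else 1) = 1 by
    rw [h, one_smul]
  rcases Nat.even_or_odd i.val with he | ho
  · refine Finset.prod_eq_one fun k _ => if_neg ?_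
    rintro ⟨hk, h⟩
    rcases h with h | h <;> grind
  · have hi := i.isLt
    have hlt : i.val + 1 < N := by grind
    have hpos : 1 ≤ i.val := by grind
    have : ∀ k : Fin N, (if Even k.val ∧ (k.val + 1 = i.val ∨ i.val + 1 = k.val)
        then (-1 : ℂ) else 1) = (if k = ⟨i.val - 1, by omega⟩ then -1 else 1) *
          (if k = ⟨i.val + 1, hlt⟩ then -1 else 1) := by
      intro k
      by_cases h1 : k.val = i.val - 1
      · have : Even (i.val - 1) := by grind
        simp [Fin.ext_iff, h1, show ¬ (i.val - 1 = i.val + 1) by omega, hpos, this]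
      · by_cases h2 : k.val = i.val + 1
        · have : Even (i.val + 1) := by grind
          simp [Fin.ext_iff, h2, this, show ¬ (i.val + 1 = i.val - 1) by omega]
        · have : ¬ (k.val + 1 = i.val ∨ i.val + 1 = k.val) := by omega
          simp [Fin.ext_iff, h1, h2, this]
    rw [Finset.prod_congr rfl fun k _ => this k, Finset.prod_mul_distrib, Finset.prod_ite_eq',
      Finset.prod_ite_eq']
    simp

/-- Odd sites are never adjacent, so each generator used to flip one of them meets Z only on zero
bits and contributes no sign. -/
theorem IsChainGraphState.apply_indicator {ψ : QubitVec N} (hψ : IsChainGraphState ψ)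
    (F : Finset (Fin N)) (hF : F ⊆ oddSites N) :
    ψ (fun j => if j ∈ F then 1 else 0) = ψ 0 := by
  induction F using Finset.induction_on with
  | empty => simp; rfl
  | insert i F hi ih =>
    rw [Finset.insert_subset_iff] at hF
    rw [← ih hF.2]
    set s : Fin N → Fin 2 := fun j => if j ∈ F then 1 else 0 with hs
    have hupd : (fun j => if j ∈ insert i F then (1 : Fin 2) else 0)
        = Function.update s i (1 - s i) := by
      ext j
      by_cases hj : j = i
      · subst hj; simp [hs, hi]
      · simp [hs, hj]
    conv_rhs => rw [← hψ.stabilized i]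
    rw [chainStabilizer_mulVec_apply, hupd]
    suffices h : chainStabilizer i s (Function.update s i (1 - s i)) = 1 by rw [h, one_mul]
    rw [chainStabilizer, tensorOp_apply]
    refine Finset.prod_eq_one fun j _ => ?_
    by_cases hj : j = i
    · subst hj; simp [hs, hi, pauliX]
    · rw [Function.update_of_ne hj]
      simp only [hj, if_false]
      split_ifs with hadj
      · have : j ∉ F := fun hjF => by
          have h1 := mem_oddSites.1 (hF.2 hjF)
          have h2 := mem_oddSites.1 hF.1
          rw [Nat.even_iff] at h1 h2
          omega
        simp [hs, this, pauliZ]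
      · simp

/-- The image is again stabilized, hence a multiple of `ψ`; comparing the entries at 0 shows that
the factor is 1. -/
theorem IsChainGraphState.oddX_mulVec (hN : Odd N) {ψ : QubitVec N} (hψ : IsChainGraphState ψ) :
    oddX N *ᵥ ψ = ψ := by
  have h := hψ.eq_smul_of_stabilized (φ := oddX N *ᵥ ψ) fun i => by
    rw [mulVec_mulVec, chainStabilizer_mul_oddX hN, ← mulVec_mulVec, hψ.stabilized]
  have h0 : (oddX N *ᵥ ψ) 0 = ψ 0 := by
    rw [← hψ.apply_indicator (oddSites N) subset_rfl, Matrix.mulVec, dotProduct]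
    rw [Finset.sum_eq_single_of_mem (fun j => if j ∈ oddSites N then 1 else 0)
      (Finset.mem_univ _)]
    · suffices h : oddX N 0 (fun j => if j ∈ oddSites N then 1 else 0) = 1 by rw [h, one_mul]
      rw [oddX, tensorOp_apply]
      refine Finset.prod_eq_one fun j _ => ?_
      by_cases hj : j ∈ oddSites N
      · simp [hj, pauliX]
      · rw [if_neg hj, if_neg hj, Pi.zero_apply, one_apply_eq]
    · intro t _ ht
      obtain ⟨j, hj⟩ := Function.ne_iff.1 ht
      rw [oddX, tensorOp_apply, Finset.prod_eq_zero (Finset.mem_univ j), zero_mul]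
      generalize t j = a at hj ⊢
      by_cases hjo : j ∈ oddSites N <;> fin_cases a <;> simp_all [pauliX]
  rw [h, h0, div_self hψ.apply_zero_ne, one_smul]

end GraphState

/-! ### Outcome laws and concentration of empirical averages -/

open MeasureTheory ProbabilityTheory

instance : DiscreteMeasurableSpace ℤˣ :=
  ⟨fun s => ⟨Units.val '' s, MeasurableSet.of_discrete, Set.preimage_image_eq s Units.val_injective⟩⟩

section Statistics

variable {N : ℕ}

theorem memLp_of_discrete {α : Type*} [Finite α] [MeasurableSpace α] [DiscreteMeasurableSpace α]
    (μ : Measure α) [IsFiniteMeasure μ] (f : α → ℝ) : MemLp f 2 μ := by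
  obtain ⟨C, hC⟩ := (Set.finite_range fun a => ‖f a‖).bddAbove
  exact MemLp.of_bound (Measurable.of_discrete.aestronglyMeasurable) C
    (Filter.Eventually.of_forall fun a => hC ⟨a, rfl⟩)

theorem bornProb_eq_expval (ρ : QubitOp N) (d : Direction) (b : Fin N → ℤˣ) :
    bornProb ρ d b = expval ρ (tensorOp fun i => d.projector (b i)) := rfl

theorem IsDensityMatrix.bornProb_nonneg {ρ : QubitOp N} (h : IsDensityMatrix ρ) (d : Direction)
    (b : Fin N → ℤˣ) : 0 ≤ bornProb ρ d b := by
  have := h.expval_mul_self_nonneg (A := tensorOp fun i => d.projector (b i))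
    (by simp only [tensorOp_conjTranspose, d.projector_conjTranspose])
  rwa [tensorOp_mul, funext fun i => d.projector_mul_self (b i)] at this

theorem sum_units {M : Type*} [AddCommMonoid M] (f : ℤˣ → M) : ∑ s, f s = f 1 + f (-1) := by
  rw [show (Finset.univ : Finset ℤˣ) = {1, -1} from rfl, Finset.sum_pair (by decide)]

/-- The mean of a correlator is the expectation value of the corresponding product observable. -/
theorem sum_bornProb_mul_correlator (ρ : QubitOp N) (d : Direction) (I : Finset (Fin N)) :
    ∑ b, bornProb ρ d b * correlator b I =
      expval ρ (tensorOp fun i => if i ∈ I then d.observable else 1) := by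
  have hop : (tensorOp fun i => if i ∈ I then d.observable else 1) =
      ∑ b : Fin N → ℤˣ, ((correlator b I : ℝ) : ℂ) • tensorOp fun i => d.projector (b i) := by
    -- Spectral decomposition at each site, with eigenvalues replaced by 1 off `I`; expanding the
    -- tensor product gives the sum over outcomes.
    have hsite : ∀ i : Fin N, (if i ∈ I then d.observable else 1) =
        ∑ s : ℤˣ, (if i ∈ I then ((s : ℤ) : ℂ) else 1) • d.projector s := by
      intro i
      rw [sum_units]
      split_ifs <;> simp only [Direction.projector] <;> push_cast <;> module
    ext s t
    simp only [hsite, tensorOp_apply, Matrix.sum_apply, Matrix.smul_apply]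
    rw [Finset.prod_univ_sum, Fintype.piFinset_univ]
    refine Finset.sum_congr rfl fun b _ => ?_
    simp only [smul_eq_mul, Finset.prod_mul_distrib, correlator, Finset.prod_ite_mem,
      Finset.univ_inter]
    push_cast
    rfl
  rw [hop, expval_sum]
  refine Finset.sum_congr rfl fun b _ => ?_
  rw [expval_smul, bornProb_eq_expval, mul_comm]

theorem IsDensityMatrix.isProbabilityMeasure_outcomeLaw {ρ : QubitOp N} (h : IsDensityMatrix ρ)
    (d : Direction) : IsProbabilityMeasure (outcomeLaw ρ d) := by
  constructor
  -- The total mass is the mean of the empty correlator.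
  have hsum : ∑ b, bornProb ρ d b = 1 := by
    have := sum_bornProb_mul_correlator ρ d ∅
    simpa [correlator, tensorOp_one, h.expval_one] using this
  simp only [outcomeLaw, Measure.coe_finsetSum, Finset.sum_apply, Measure.smul_apply,
    measure_univ, smul_eq_mul, mul_one]
  rw [← ENNReal.ofReal_sum_of_nonneg fun b _ => h.bornProb_nonneg d b, hsum, ENNReal.ofReal_one]

theorem IsDensityMatrix.integral_outcomeLaw {ρ : QubitOp N} (h : IsDensityMatrix ρ)
    (d : Direction) (f : (Fin N → ℤˣ) → ℝ) :
    ∫ b, f b ∂(outcomeLaw ρ d) = ∑ b, bornProb ρ d b * f b := by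
  rw [outcomeLaw, integral_finsetSum_measure fun b _ =>
    (integrable_dirac (by simp)).smul_measure ENNReal.ofReal_ne_top]
  refine Finset.sum_congr rfl fun b _ => ?_
  rw [integral_smul_measure, integral_dirac, ENNReal.toReal_ofReal (h.bornProb_nonneg d b),
    smul_eq_mul]

theorem IsDensityMatrix.integral_correlator {ρ : QubitOp N} (h : IsDensityMatrix ρ)
    (d : Direction) (I : Finset (Fin N)) :
    ∫ b, correlator b I ∂(outcomeLaw ρ d) =
      expval ρ (tensorOp fun i => if i ∈ I then d.observable else 1) := by
  rw [h.integral_outcomeLaw, sum_bornProb_mul_correlator]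

theorem IsDensityMatrix.isProbabilityMeasure_dataLaw {ρ : QubitOp N} (h : IsDensityMatrix ρ)
    (T : ℕ) : IsProbabilityMeasure (dataLaw ρ T) := by
  have := fun k : Direction × Fin T => h.isProbabilityMeasure_outcomeLaw k.1
  unfold dataLaw
  infer_instance

/-- The empirical average of a statistic `f`, which may weigh the three directions differently. -/
noncomputable def empMean {T : ℕ} (f : Direction → (Fin N → ℤˣ) → ℝ) (data : Data N T) : ℝ :=
  (1 / (T : ℝ)) * ∑ k : Direction × Fin T, f k.1 (data k)

/-- The expectation of `empMean f`. -/
noncomputable def trueMean (ρ : QubitOp N) (f : Direction → (Fin N → ℤˣ) → ℝ) : ℝ :=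
  ∑ d, ∫ b, f d b ∂(outcomeLaw ρ d)

theorem sum_direction {M : Type*} [AddCommMonoid M] (f : Direction → M) :
    ∑ d, f d = f .x + f .xzPlus + f .xzMinus := by
  rw [show (Finset.univ : Finset Direction) = {.x, .xzPlus, .xzMinus} from rfl,
    Finset.sum_insert (by decide), Finset.sum_pair (by decide), add_assoc]

/-- Chebyshev's inequality for empirical averages. -/
theorem IsDensityMatrix.measureReal_deviation_le {ρ : QubitOp N} (h : IsDensityMatrix ρ) {T : ℕ}
    (hT : 0 < T) {f : Direction → (Fin N → ℤˣ) → ℝ} (hf : ∀ d b, |f d b| ≤ 2) {δ : ℝ}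
    (hδ : 0 < δ) :
    (dataLaw ρ T).real {data | δ ≤ |empMean f data - trueMean ρ f|} ≤ 12 / (T * δ ^ 2) := by
  have hp := fun k : Direction × Fin T => h.isProbabilityMeasure_outcomeLaw k.1
  have hp' := h.isProbabilityMeasure_dataLaw T
  have hT' : (0 : ℝ) < T := by exact_mod_cast hT
  have hL : ∀ k : Direction × Fin T, MemLp (f k.1) 2 (outcomeLaw ρ k.1) :=
    fun k => memLp_of_discrete _ _
  set Y : Data N T → ℝ := ∑ k : Direction × Fin T, fun data => f k.1 (data k) with hY
  have hYapp : ∀ data, Y data = ∑ k : Direction × Fin T, f k.1 (data k) := fun data => by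
    simp [hY]
  -- There are `3T` independent terms, each of variance at most 2² = 4.
  have hvar : Var[Y; dataLaw ρ T] ≤ 12 * T := by
    rw [hY, dataLaw, variance_sum_pi hL]
    calc ∑ k : Direction × Fin T, Var[f k.1; outcomeLaw ρ k.1]
        ≤ ∑ k : Direction × Fin T, (4 : ℝ) := by
          refine Finset.sum_le_sum fun k _ => ?_
          refine (variance_le_expectation_sq (hL k).1).trans ?_
          rw [h.integral_outcomeLaw]
          have h1 : ∑ b, bornProb ρ k.1 b = 1 := by
            have := h.integral_outcomeLaw k.1 fun _ => 1
            simpa using this.symm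
          calc ∑ b, bornProb ρ k.1 b * (f k.1 ^ 2) b ≤ ∑ b, bornProb ρ k.1 b * 4 := by
                refine Finset.sum_le_sum fun b _ =>
                  mul_le_mul_of_nonneg_left ?_ (h.bornProb_nonneg _ _)
                have := abs_le.1 (hf k.1 b)
                simp only [Pi.pow_apply]
                nlinarith
            _ = 4 := by rw [← Finset.sum_mul, h1, one_mul]
      _ = 12 * T := by
          simp only [Finset.sum_const, Finset.card_univ, Fintype.card_prod, Fintype.card_fin,
            show Fintype.card Direction = 3 from rfl]
          simp; ring
  have hmean : ∫ data, Y data ∂(dataLaw ρ T) = T * trueMean ρ f := by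
    simp only [hYapp]
    rw [integral_finsetSum _ fun k _ => (memLp_of_discrete _ _).integrable (by norm_num)]
    have : ∀ k : Direction × Fin T, ∫ data, f k.1 (data k) ∂(dataLaw ρ T) =
        ∫ b, f k.1 b ∂(outcomeLaw ρ k.1) := fun k =>
      integral_comp_eval (μ := fun k : Direction × Fin T => outcomeLaw ρ k.1) (hL k).1
    simp only [this, Fintype.sum_prod_type, trueMean, Finset.mul_sum, Finset.sum_const,
      Finset.card_univ, Fintype.card_fin, nsmul_eq_mul]
  have hcheb := meas_ge_le_variance_div_sq (memLp_of_discrete (dataLaw ρ T) Y)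
    (c := T * δ) (by positivity)
  have hset : {data | δ ≤ |empMean f data - trueMean ρ f|} =
      {data | T * δ ≤ |Y data - ∫ x, Y x ∂(dataLaw ρ T)|} := by
    ext data
    have : Y data - ∫ x, Y x ∂(dataLaw ρ T) = T * (empMean f data - trueMean ρ f) := by
      rw [hmean, hYapp, empMean]
      field_simp
    simp only [Set.mem_ofPred_eq, this, abs_mul, abs_of_pos hT']
    exact (mul_le_mul_iff_right₀ hT').symm
  rw [hset]
  have hnn : 0 ≤ Var[Y; dataLaw ρ T] / (T * δ) ^ 2 :=
    div_nonneg (variance_nonneg _ _) (by positivity)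
  calc _ ≤ Var[Y; dataLaw ρ T] / (T * δ) ^ 2 := ENNReal.toReal_le_of_le_ofReal hnn hcheb
    _ ≤ 12 * T / (T * δ) ^ 2 := by gcongr
    _ = 12 / (T * δ ^ 2) := by field_simp

end Statistics

/-! ### Means of the estimators and their distance from the stabilizers -/

section Estimators

variable {N : ℕ}

theorem abs_correlator (b : Fin N → ℤˣ) (I : Finset (Fin N)) : |correlator b I| = 1 := by
  rw [correlator, Finset.abs_prod]
  refine Finset.prod_eq_one fun i _ => ?_
  rcases Int.units_eq_one_or (b i) with h | h <;> simp [h]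

/-- An operator string with a single `Z` on the odd sites, at `p`, and otherwise only factors that
commute with `X` there, anticommutes with the product of `X` over the odd sites. -/
theorem tensorOp_mul_oddX_of_unique {A : Fin N → Matrix (Fin 2) (Fin 2) ℂ} {p : Fin N}
    (hp : p ∈ oddSites N) (hAp : A p = pauliZ)
    (hA : ∀ j ∈ oddSites N, j ≠ p → A j = pauliX ∨ A j = 1) :
    oddX N * tensorOp A = -(tensorOp A * oddX N) := by
  rw [oddX, tensorOp_mul_comm fun k => if k = p then -1 else 1, Finset.prod_ite_eq']
  · simp
  · intro k
    by_cases hk : k = p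
    · subst hk; simp [hp, hAp, pauliX_mul_pauliZ]
    · by_cases hko : k ∈ oddSites N
      · rcases hA k hko hk with h | h <;> simp [hk, hko, h]
      · simp [hk, hko]

theorem IsDensityMatrix.abs_expval_le {ρ : QubitOp N} (h : IsDensityMatrix ρ)
    {A : QubitOp N} (hA : IsReflection A) (hAU : oddX N * A = -(A * oddX N)) :
    |expval ρ A| ≤ √(1 - expval ρ (oddX N) ^ 2) := by
  apply Real.abs_le_sqrt
  linarith [h.expval_sq_add_sq_le_one isReflection_oddX hA hAU]

/-- The operators `A`, `B` on the sites `a`, `b`. -/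
def twoSite (a b : Fin N) (A B : Matrix (Fin 2) (Fin 2) ℂ) (j : Fin N) :
    Matrix (Fin 2) (Fin 2) ℂ :=
  if j = a then A else if j = b then B else 1

/-- The operators `A`, `B`, `C` on the sites `a`, `b`, `c`. -/
def threeSite (a b c : Fin N) (A B C : Matrix (Fin 2) (Fin 2) ℂ) (j : Fin N) :
    Matrix (Fin 2) (Fin 2) ℂ :=
  if j = a then A else if j = b then B else if j = c then C else 1

theorem isReflection_twoSite (a b : Fin N) {A B : Matrix (Fin 2) (Fin 2) ℂ}
    (hA : IsReflection A) (hB : IsReflection B) :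
    IsReflection (tensorOp (twoSite a b A B)) := by
  refine IsReflection.tensorOp fun j => ?_
  unfold twoSite
  split_ifs
  exacts [hA, hB, isReflection_one]

theorem isReflection_threeSite (a b c : Fin N) {A B C : Matrix (Fin 2) (Fin 2) ℂ}
    (hA : IsReflection A) (hB : IsReflection B) (hC : IsReflection C) :
    IsReflection (tensorOp (threeSite a b c A B C)) := by
  refine IsReflection.tensorOp fun j => ?_
  unfold threeSite
  split_ifs
  exacts [hA, hB, hC, isReflection_one]

/-- Splitting off the identity factors reduces operator identities to polynomial identities between
matrix entries. -/
theorem tensorOp_twoSite_apply {a b : Fin N} (hab : a ≠ b) (A B : Matrix (Fin 2) (Fin 2) ℂ)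
    (s t : Fin N → Fin 2) :
    tensorOp (twoSite a b A B) s t =
      (∏ j ∈ Finset.univ \ {a, b}, (1 : Matrix (Fin 2) (Fin 2) ℂ) (s j) (t j)) *
        (A (s a) (t a) * B (s b) (t b)) := by
  rw [tensorOp_apply, ← Finset.prod_sdiff (Finset.subset_univ {a, b}), Finset.prod_pair hab]
  congr 1
  · refine Finset.prod_congr rfl fun j hj => ?_
    simp only [Finset.mem_sdiff, Finset.mem_insert, Finset.mem_singleton, not_or] at hj
    simp [twoSite, hj.2.1, hj.2.2]
  · simp [twoSite, hab.symm]

theorem tensorOp_threeSite_apply {a b c : Fin N} (hab : a ≠ b) (hac : a ≠ c) (hbc : b ≠ c)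
    (A B C : Matrix (Fin 2) (Fin 2) ℂ) (s t : Fin N → Fin 2) :
    tensorOp (threeSite a b c A B C) s t =
      (∏ j ∈ Finset.univ \ {a, b, c}, (1 : Matrix (Fin 2) (Fin 2) ℂ) (s j) (t j)) *
        (A (s a) (t a) * (B (s b) (t b) * C (s c) (t c))) := by
  rw [tensorOp_apply, ← Finset.prod_sdiff (Finset.subset_univ {a, b, c}),
    Finset.prod_insert (by simp [hab, hac]), Finset.prod_pair hbc]
  congr 1
  · refine Finset.prod_congr rfl fun j hj => ?_
    simp only [Finset.mem_sdiff, Finset.mem_insert, Finset.mem_singleton, not_or] at hj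
    simp [threeSite, hj.2.1, hj.2.2]
  · simp [threeSite, hab.symm, hac.symm, hbc.symm]

theorem twoSite_same (a b : Fin N) (A : Matrix (Fin 2) (Fin 2) ℂ) :
    (fun j => if j ∈ ({a, b} : Finset (Fin N)) then A else 1) = twoSite a b A A := by
  ext1 j
  simp only [Finset.mem_insert, Finset.mem_singleton, twoSite]
  split_ifs <;> simp_all

theorem threeSite_same (a b c : Fin N) (A : Matrix (Fin 2) (Fin 2) ℂ) :
    (fun j => if j ∈ ({a, b, c} : Finset (Fin N)) then A else 1) = threeSite a b c A A A := by
  ext1 j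
  simp only [Finset.mem_insert, Finset.mem_singleton, threeSite]
  split_ifs <;> simp_all

/-- The difference keeps the terms odd in Z, with weight 2(1/√2)² = 1. -/
theorem twoSite_observable {a b : Fin N} (hab : a ≠ b) :
    tensorOp (twoSite a b Direction.xzPlus.observable Direction.xzPlus.observable) -
      tensorOp (twoSite a b Direction.xzMinus.observable Direction.xzMinus.observable) =
    tensorOp (twoSite a b pauliX pauliZ) + tensorOp (twoSite a b pauliZ pauliX) := by
  ext s t
  simp only [Matrix.sub_apply, Matrix.add_apply, tensorOp_twoSite_apply hab, Direction.observable,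
    Matrix.smul_apply, smul_eq_mul]
  linear_combination (2 * (∏ j ∈ Finset.univ \ {a, b},
    (1 : Matrix (Fin 2) (Fin 2) ℂ) (s j) (t j)) * (pauliX (s a) (t a) * pauliZ (s b) (t b) +
      pauliZ (s a) (t a) * pauliX (s b) (t b))) * sqrt_two_inv_sq

/-- The sum keeps the terms even in Z, with weight 2√2(1/√2)³ = 1; among them XXX is removed by the
subtraction. -/
theorem threeSite_observable {a b c : Fin N} (hab : a ≠ b) (hac : a ≠ c) (hbc : b ≠ c) :
    ((√2 : ℝ) : ℂ) • (tensorOp (threeSite a b c Direction.xzPlus.observable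
        Direction.xzPlus.observable Direction.xzPlus.observable) +
      tensorOp (threeSite a b c Direction.xzMinus.observable
        Direction.xzMinus.observable Direction.xzMinus.observable)) -
      tensorOp (threeSite a b c pauliX pauliX pauliX) =
    tensorOp (threeSite a b c pauliX pauliZ pauliZ) +
      tensorOp (threeSite a b c pauliZ pauliX pauliZ) +
      tensorOp (threeSite a b c pauliZ pauliZ pauliX) := by
  have hr : ((√2 : ℝ) : ℂ) * ((√2 : ℝ) : ℂ)⁻¹ = 1 :=
    mul_inv_cancel₀ (Complex.ofReal_ne_zero.2 (by positivity))
  ext s t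
  simp only [Matrix.sub_apply, Matrix.add_apply, tensorOp_threeSite_apply hab hac hbc,
    Direction.observable, Matrix.smul_apply, smul_eq_mul]
  have hr3 : ((√2 : ℝ) : ℂ) * ((√2 : ℝ) : ℂ)⁻¹ ^ 3 = 1 / 2 := by
    linear_combination (((√2 : ℝ) : ℂ)⁻¹ * ((√2 : ℝ) : ℂ)⁻¹) * hr + sqrt_two_inv_sq
  linear_combination (2 * (∏ j ∈ Finset.univ \ {a, b, c},
    (1 : Matrix (Fin 2) (Fin 2) ℂ) (s j) (t j)) *
      (pauliX (s a) (t a) * pauliX (s b) (t b) * pauliX (s c) (t c) +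
      pauliX (s a) (t a) * pauliZ (s b) (t b) * pauliZ (s c) (t c) +
      pauliZ (s a) (t a) * pauliX (s b) (t b) * pauliZ (s c) (t c) +
      pauliZ (s a) (t a) * pauliZ (s b) (t b) * pauliX (s c) (t c))) * hr3

/-- The statistic behind `empU`. -/
noncomputable def statU (N : ℕ) : Direction → (Fin N → ℤˣ) → ℝ
  | .x, b => correlator b (oddSites N)
  | _, _ => 0

/-- The statistic behind `empM`. -/
noncomputable def statM (i : Fin N) (d : Direction) (b : Fin N → ℤˣ) : ℝ :=
  (if i.val = 0 ∨ i.val + 1 = N then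
    match d with
    | .x => 0
    | .xzPlus => 1
    | .xzMinus => -1
  else
    match d with
    | .x => -1
    | .xzPlus => √2
    | .xzMinus => √2) * correlator b (closedNbhd i)

theorem abs_statU_le (d : Direction) (b : Fin N → ℤˣ) : |statU N d b| ≤ 2 := by
  cases d <;> simp [statU, abs_correlator]

theorem sqrt_two_le_two : √2 ≤ 2 := by
  rw [Real.sqrt_le_left (by norm_num)]; norm_num

theorem abs_statM_le (i : Fin N) (d : Direction) (b : Fin N → ℤˣ) : |statM i d b| ≤ 2 := by
  have := sqrt_two_le_two
  rw [statM.eq_def, abs_mul, abs_correlator, mul_one]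
  split_ifs <;> cases d <;> simp [abs_of_nonneg (Real.sqrt_nonneg 2), this]

theorem empU_eq {T : ℕ} (data : Data N T) : empU data = empMean (statU N) data := by
  simp [empU, empMean, Fintype.sum_prod_type, sum_direction, statU]

theorem empM_eq {T : ℕ} (data : Data N T) (i : Fin N) :
    empM data i = empMean (statM i) data := by
  simp only [empM, empMean, Fintype.sum_prod_type, sum_direction, statM, ← Finset.sum_add_distrib]
  split_ifs <;> congr 1 <;> refine Finset.sum_congr rfl fun t _ => ?_ <;> ring

theorem IsDensityMatrix.trueMean_statU {ρ : QubitOp N} (h : IsDensityMatrix ρ) :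
    trueMean ρ (statU N) = expval ρ (oddX N) := by
  simp [trueMean, sum_direction, statU, h.integral_correlator, Direction.observable, oddX]

/-- At an end `i` of the chain, with neighbour `j`, the mean of the estimator differs from the
stabilizer by one term that anticommutes with `oddX`. -/
theorem IsDensityMatrix.trueMean_statM_end {ρ : QubitOp N} (h : IsDensityMatrix ρ) {i j : Fin N}
    (hi : i.val = 0 ∨ i.val + 1 = N) (hi2 : Even i.val) (hj2 : ¬ Even j.val)
    (hI : closedNbhd i = {i, j})
    (hadj : ∀ k : Fin N, (k.val + 1 = i.val ∨ i.val + 1 = k.val) ↔ k = j) :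
    |trueMean ρ (statM i) - expval ρ (chainStabilizer i)| ≤
      2 * √(1 - expval ρ (oddX N) ^ 2) := by
  have hij : i ≠ j := fun hh => hj2 (hh ▸ hi2)
  have hS : chainStabilizer i = tensorOp (twoSite i j pauliX pauliZ) := by
    simp only [chainStabilizer, hadj]; rfl
  have hmean : trueMean ρ (statM i) = expval ρ (chainStabilizer i) +
      expval ρ (tensorOp (twoSite i j pauliZ pauliX)) := by
    rw [hS, ← expval_add, ← twoSite_observable hij, expval_sub]
    simp only [trueMean, sum_direction, statM, hi, if_true, integral_const_mul,
      h.integral_correlator, hI, twoSite_same]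
    ring
  have hA := h.abs_expval_le (isReflection_twoSite i j isReflection_pauliZ isReflection_pauliX)
    (tensorOp_mul_oddX_of_unique (p := i) (mem_oddSites.2 hi2) (by simp [twoSite])
      fun k hk hki => by
        have : k ≠ j := fun hh => hj2 (hh ▸ mem_oddSites.1 hk)
        simp [twoSite, hki, this])
  rw [hmean, add_sub_cancel_left]
  -- A single error term arises here; the factor 2 is slack that matches the interior case.
  linarith [Real.sqrt_nonneg (1 - expval ρ (oddX N) ^ 2)]

/-- The unwanted strings are XZZ and ZZX. If the centre is an odd site, it carries their only Z on
odd sites; if not, the odd sites among the three are the outer ones, one carrying X and the other Z.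
-/
theorem IsDensityMatrix.trueMean_statM_interior {ρ : QubitOp N} (h : IsDensityMatrix ρ)
    {a i c : Fin N} (ha : a.val + 1 = i.val) (hc : i.val + 1 = c.val) :
    |trueMean ρ (statM i) - expval ρ (chainStabilizer i)| ≤
      2 * √(1 - expval ρ (oddX N) ^ 2) := by
  have hcN := c.isLt
  have hi : ¬ (i.val = 0 ∨ i.val + 1 = N) := by omega
  have hai : a ≠ i := fun hh => by rw [Fin.ext_iff] at hh; omega
  have hac : a ≠ c := fun hh => by rw [Fin.ext_iff] at hh; omega
  have hic : i ≠ c := fun hh => by rw [Fin.ext_iff] at hh; omega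
  have hI : closedNbhd i = {a, i, c} := by
    ext k
    simp only [closedNbhd, Finset.mem_filter, Finset.mem_univ, true_and, Finset.mem_insert,
      Finset.mem_singleton, Fin.ext_iff]
    omega
  have hS : chainStabilizer i = tensorOp (threeSite a i c pauliZ pauliX pauliZ) := by
    rw [chainStabilizer]
    congr 1
    ext1 k
    have h1 : (k.val + 1 = i.val ∨ i.val + 1 = k.val) ↔ k = a ∨ k = c := by
      simp only [Fin.ext_iff]; omega
    simp only [h1, threeSite]
    split_ifs <;> simp_all
  have hmean : trueMean ρ (statM i) = expval ρ (chainStabilizer i) +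
      (expval ρ (tensorOp (threeSite a i c pauliX pauliZ pauliZ)) +
        expval ρ (tensorOp (threeSite a i c pauliZ pauliZ pauliX))) := by
    have hop := congrArg (expval ρ) (threeSite_observable hai hac hic)
    simp only [expval_add, expval_sub, expval_smul] at hop
    rw [hS]
    simp only [trueMean, sum_direction, statM, hi, if_false, integral_const_mul,
      h.integral_correlator, hI, threeSite_same]
    rw [show Direction.x.observable = pauliX from rfl]
    linarith
  have hX := isReflection_pauliX
  have hZ := isReflection_pauliZ
  have hA : oddX N * tensorOp (threeSite a i c pauliX pauliZ pauliZ) =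
      -(tensorOp (threeSite a i c pauliX pauliZ pauliZ) * oddX N) := by
    by_cases he : Even i.val
    · refine tensorOp_mul_oddX_of_unique (p := i) (mem_oddSites.2 he)
        (by simp [threeSite, hai.symm]) fun k hk hki => ?_
      have : k ≠ c := fun hh => by subst hh; have := mem_oddSites.1 hk; grind
      by_cases hka : k = a <;> simp [threeSite, hka, hki, this]
    · refine tensorOp_mul_oddX_of_unique (p := c) (mem_oddSites.2 (by grind))
        (by simp [threeSite, hac.symm, hic.symm]) fun k hk hkc => ?_
      have : k ≠ i := fun hh => he (hh ▸ mem_oddSites.1 hk)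
      by_cases hka : k = a <;> simp [threeSite, hka, hkc, this]
  have hB : oddX N * tensorOp (threeSite a i c pauliZ pauliZ pauliX) =
      -(tensorOp (threeSite a i c pauliZ pauliZ pauliX) * oddX N) := by
    by_cases he : Even i.val
    · refine tensorOp_mul_oddX_of_unique (p := i) (mem_oddSites.2 he)
        (by simp [threeSite, hai.symm]) fun k hk hki => ?_
      have : k ≠ a := fun hh => by subst hh; have := mem_oddSites.1 hk; grind
      by_cases hkc : k = c <;> simp [threeSite, hkc, hki, this, hac.symm, hic.symm]
    · refine tensorOp_mul_oddX_of_unique (p := a) (mem_oddSites.2 (by grind))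
        (by simp [threeSite]) fun k hk hka => ?_
      have : k ≠ i := fun hh => he (hh ▸ mem_oddSites.1 hk)
      by_cases hkc : k = c <;> simp [threeSite, hka, hkc, this, hac.symm, hic.symm]
  have h1 := abs_le.1 (h.abs_expval_le (isReflection_threeSite a i c hX hZ hZ) hA)
  have h2 := abs_le.1 (h.abs_expval_le (isReflection_threeSite a i c hZ hZ hX) hB)
  rw [hmean, add_sub_cancel_left, abs_le]
  constructor <;> linarith

theorem IsDensityMatrix.abs_trueMean_statM_sub_le (hN : Odd N) (hN3 : 3 ≤ N) {ρ : QubitOp N}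
    (h : IsDensityMatrix ρ) (i : Fin N) :
    |trueMean ρ (statM i) - expval ρ (chainStabilizer i)| ≤
      2 * √(1 - expval ρ (oddX N) ^ 2) := by
  have hlt := i.isLt
  rw [Nat.odd_iff] at hN
  by_cases h0 : i.val = 0
  · refine h.trueMean_statM_end (j := ⟨1, by omega⟩) (Or.inl h0) (by simp [h0]) (by simp) ?_ ?_
    · ext k
      simp only [closedNbhd, Finset.mem_filter, Finset.mem_univ, true_and, Finset.mem_insert,
        Finset.mem_singleton, Fin.ext_iff]
      omega
    · intro k
      rw [Fin.ext_iff]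
      simp only
      omega
  by_cases h1 : i.val + 1 = N
  · refine h.trueMean_statM_end (j := ⟨i.val - 1, by omega⟩) (Or.inr h1)
      (by rw [Nat.even_iff]; omega) (by rw [Nat.even_iff]; simp only; omega) ?_ ?_
    · ext k
      simp only [closedNbhd, Finset.mem_filter, Finset.mem_univ, true_and, Finset.mem_insert,
        Finset.mem_singleton, Fin.ext_iff]
      omega
    · intro k
      rw [Fin.ext_iff]
      simp only
      omega
  exact h.trueMean_statM_interior (a := ⟨i.val - 1, by omega⟩) (c := ⟨i.val + 1, by omega⟩)
    (by simp only; omega) rfl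

end Estimators

/-! ### Completeness, soundness and the choice of constants -/

section Certification

variable {N : ℕ}

/-- Since 1 - (1 - cε)² ≤ 2cε; `hε` makes 1 - cε nonnegative, so that squaring preserves the order.
-/
theorem sqrt_one_sub_expval_oddX_sq_le {ρ : QubitOp N} {ε c : ℝ} (hc : 0 ≤ c)
    (hε : c * ε ≤ 1) (hu : 1 - c * ε ≤ expval ρ (oddX N)) :
    √(1 - expval ρ (oddX N) ^ 2) ≤ √(2 * c) * √ε := by
  rw [← Real.sqrt_mul (by positivity)]
  apply Real.sqrt_le_sqrt
  nlinarith [pow_le_pow_left₀ (sub_nonneg.2 hε) hu 2, sq_nonneg (c * ε)]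

theorem IsDensityMatrix.one_sub_le_verdictProb {ρ : QubitOp N} (h : IsDensityMatrix ρ) {T : ℕ}
    {ε : ℝ} {v : Verdict} (bad : Set (Data N T)) (hbad : ∀ data ∉ bad, certify ε data = v) :
    1 - (dataLaw ρ T).real bad ≤ verdictProb ρ T ε v := by
  have := h.isProbabilityMeasure_dataLaw T
  have h1 : (dataLaw ρ T).real Set.univ ≤
      (dataLaw ρ T).real ({data | certify ε data = v} ∪ bad) := by
    refine measureReal_mono fun data _ => ?_
    by_cases hd : data ∈ bad
    · exact Or.inr hd
    · exact Or.inl (hbad data hd)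
  have h2 := measureReal_union_le (μ := dataLaw ρ T) {data | certify ε data = v} bad
  rw [probReal_univ] at h1
  rw [verdictProb]
  linarith

/-- Both ⟨U⟩ and ⟨Sᵢ⟩ exceed 1 - 2ε. The bias of at most 4√ε and a sampling error below √ε leave
each estimator above 1 - 2ε - 5√ε, which exceeds 1 - 9√ε. -/
theorem le_verdictProb_certified (hN : Odd N) (hN3 : 3 ≤ N) {ε : ℝ} (hε : 0 < ε)
    (hεN : ε < 1 / (64 * (N : ℝ) ^ 2)) {T : ℕ} (hT : 100 / ε ^ 2 ≤ T) {ψ : QubitVec N}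
    {ρ : QubitOp N} (hψ : IsChainGraphState ψ) (hρ : IsDensityMatrix ρ)
    (hF : 1 - ε < fidelity ψ ρ) : 2 / 3 ≤ verdictProb ρ T ε .certified := by
  have hN3' : (3 : ℝ) ≤ N := by exact_mod_cast hN3
  rw [lt_div_iff₀ (by positivity)] at hεN
  have hε1 : ε < 1 / 576 := by nlinarith
  have hNε : N * ε ≤ 1 / 192 := by nlinarith
  rw [div_le_iff₀ (by positivity)] at hT
  have hTpos : (0 : ℝ) < T := by
    by_contra hneg
    nlinarith [sq_nonneg ε]
  have hTnat : 0 < T := by exact_mod_cast hTpos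
  set q := √ε with hq
  have hq0 : 0 < q := Real.sqrt_pos.2 hε
  have hqq : q ^ 2 = ε := Real.sq_sqrt hε.le
  have hq1 : q < 1 := by nlinarith
  have hu := hρ.le_expval_of_mulVec_eq hψ.unit isReflection_oddX (hψ.oddX_mulVec hN)
  have hsq : √(1 - expval ρ (oddX N) ^ 2) ≤ 2 * q := by
    have := sqrt_one_sub_expval_oddX_sq_le (ρ := ρ) (ε := ε) (c := 2) (by norm_num)
      (by linarith) (by linarith)
    rwa [show (2 * 2 : ℝ) = 2 ^ 2 by norm_num, Real.sqrt_sq (by norm_num)] at this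
  -- The margin is 13ε/4 - 2ε = 5ε/4.
  set badU : Set (Data N T) :=
    {data | 5 * ε / 4 ≤ |empMean (statU N) data - trueMean ρ (statU N)|} with hbadU
  set badM : Fin N → Set (Data N T) :=
    fun i => {data | q ≤ |empMean (statM i) data - trueMean ρ (statM i)|} with hbadM
  have hUle : (dataLaw ρ T).real badU ≤ 1 / 10 := by
    refine (hρ.measureReal_deviation_le hTnat abs_statU_le (by positivity)).trans ?_
    rw [div_le_iff₀ (by positivity)]
    nlinarith
  have hMle : (dataLaw ρ T).real (⋃ i, badM i) ≤ 1 / 10 := by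
    refine (measureReal_iUnion_fintype_le _).trans ?_
    refine (Finset.sum_le_sum fun i _ =>
      hρ.measureReal_deviation_le hTnat (abs_statM_le i) hq0).trans ?_
    rw [Finset.sum_const, Finset.card_univ, Fintype.card_fin, nsmul_eq_mul, hqq, ← mul_div_assoc,
      div_le_iff₀ (by positivity)]
    -- The union over `N` estimators is paid for by `hNε`, not by a larger `T`.
    have h1 : N * 12 * ε ≤ 1 / 10 * (T * ε ^ 2) := by linarith
    nlinarith
  have hcert := hρ.one_sub_le_verdictProb (T := T) (ε := ε) (v := .certified) (badU ∪ ⋃ i, badM i) (by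
    intro data hdata
    rw [Set.mem_union, not_or, Set.mem_iUnion, not_exists] at hdata
    obtain ⟨hdU, hdM⟩ := hdata
    have h1 : |empMean (statU N) data - trueMean ρ (statU N)| < 5 * ε / 4 := not_le.1 hdU
    rw [hρ.trueMean_statU, abs_lt, ← empU_eq] at h1
    rw [certify, if_neg (by linarith), if_pos]
    intro i
    have h2 : |empMean (statM i) data - trueMean ρ (statM i)| < q := not_le.1 (hdM i)
    rw [abs_lt, ← empM_eq] at h2
    have h3 := abs_le.1 (hρ.abs_trueMean_statM_sub_le hN hN3 i)
    have h4 := hρ.le_expval_of_mulVec_eq hψ.unit (isReflection_chainStabilizer i)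
      (hψ.stabilized i)
    nlinarith)
  have := measureReal_union_le (μ := dataLaw ρ T) badU (⋃ i, badM i)
  linarith

/-- If ⟨U⟩ < 1 - 4ε, the test of U fails with margin 4ε - 13ε/4 = 3ε/4. Otherwise some ⟨Sᵢ⟩ < 1 -
16√ε; the bias is at most 6√ε and the sampling error below √ε, so that estimator stays under 1 -
9√ε. Only one estimator has to be controlled in either case. -/
theorem le_verdictProb_failed (hN : Odd N) (hN3 : 3 ≤ N) {ε : ℝ} (hε : 0 < ε)
    (hεN : ε < 1 / (64 * (N : ℝ) ^ 2)) {T : ℕ} (hT : 100 / ε ^ 2 ≤ T) {ψ : QubitVec N}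
    {ρ : QubitOp N} (hψ : IsChainGraphState ψ) (hρ : IsDensityMatrix ρ)
    (hF : fidelity ψ ρ < 1 - 8 * (N : ℝ) * √ε) : 2 / 3 ≤ verdictProb ρ T ε .failed := by
  have hN3' : (3 : ℝ) ≤ N := by exact_mod_cast hN3
  rw [lt_div_iff₀ (by positivity)] at hεN
  have hε1 : ε < 1 / 576 := by nlinarith
  rw [div_le_iff₀ (by positivity)] at hT
  have hTpos : (0 : ℝ) < T := by
    by_contra hneg
    nlinarith [sq_nonneg ε]
  have hTnat : 0 < T := by exact_mod_cast hTpos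
  set q := √ε with hq
  have hq0 : 0 < q := Real.sqrt_pos.2 hε
  have hqq : q ^ 2 = ε := Real.sq_sqrt hε.le
  by_cases hu : 1 - 4 * ε ≤ expval ρ (oddX N)
  · have hsq : √(1 - expval ρ (oddX N) ^ 2) ≤ 3 * q := by
      refine (sqrt_one_sub_expval_oddX_sq_le (by norm_num) (by linarith) hu).trans ?_
      gcongr
      rw [Real.sqrt_le_left (by norm_num)]
      norm_num
    -- Otherwise the union bound would give infidelity at most 8N√ε.
    obtain ⟨i, hi⟩ : ∃ i : Fin N, expval ρ (chainStabilizer i) < 1 - 16 * q := by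
      by_contra hcon
      push Not at hcon
      have h1 := one_sub_fidelity_le hρ hψ
      have h2 : ∑ i : Fin N, (1 - expval ρ (chainStabilizer i)) / 2 ≤ ∑ _i : Fin N, 8 * q :=
        Finset.sum_le_sum fun i _ => by linarith [hcon i]
      rw [Finset.sum_const, Finset.card_univ, Fintype.card_fin, nsmul_eq_mul] at h2
      linarith
    have h3 := abs_le.1 (hρ.abs_trueMean_statM_sub_le hN hN3 i)
    have hle := hρ.measureReal_deviation_le hTnat (abs_statM_le i) hq0
    have hfail := hρ.one_sub_le_verdictProb (T := T) (ε := ε) (v := .failed)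
      {data | q ≤ |empMean (statM i) data - trueMean ρ (statM i)|} (by
        intro data hdata
        have h2 : |empMean (statM i) data - trueMean ρ (statM i)| < q := not_le.1 hdata
        rw [abs_lt, ← empM_eq] at h2
        rw [certify]
        split_ifs with h4 h5
        · rfl
        · have := h5 i
          linarith
        · rfl)
    have : 12 / (T * q ^ 2) ≤ 1 / 3 := by
      rw [hqq, div_le_iff₀ (by positivity)]
      nlinarith
    linarith
  · push Not at hu
    have hle := hρ.measureReal_deviation_le hTnat abs_statU_le (δ := 3 * ε / 4) (by positivity)
    have hfail := hρ.one_sub_le_verdictProb (T := T) (ε := ε) (v := .failed)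
      {data | 3 * ε / 4 ≤ |empMean (statU N) data - trueMean ρ (statU N)|} (by
        intro data hdata
        have h2 : |empMean (statU N) data - trueMean ρ (statU N)| < 3 * ε / 4 := not_le.1 hdata
        rw [hρ.trueMean_statU, abs_lt, ← empU_eq] at h2
        rw [certify, if_pos (by linarith)])
    have : 12 / (T * (3 * ε / 4) ^ 2) ≤ 1 / 3 := by
      rw [div_le_iff₀ (by positivity)]
      nlinarith
    linarith

end Certification

end UniformCertification

theorem theorem1 :
    ∃ C : ℝ, 0 < C ∧
      ∀ N : ℕ, Odd N → 3 ≤ N →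
      ∀ ε : ℝ, 0 < ε → ε < 1 / (64 * (N : ℝ) ^ 2) →
      ∃ T₀ : ℕ, (T₀ : ℝ) ≤ C / ε ^ 2 ∧
        ∀ T : ℕ, T₀ ≤ T →
        ∀ (ψ : UniformCertification.QubitVec N) (ρ : UniformCertification.QubitOp N),
          UniformCertification.IsChainGraphState ψ →
          UniformCertification.IsDensityMatrix ρ →
          (1 - ε < UniformCertification.fidelity ψ ρ →
            2 / 3 ≤ UniformCertification.verdictProb ρ T ε .certified) ∧
          (UniformCertification.fidelity ψ ρ < 1 - 8 * (N : ℝ) * Real.sqrt ε →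
            2 / 3 ≤ UniformCertification.verdictProb ρ T ε .failed) := by
  -- The extra 1/ε² ≥ 1 absorbs the rounding.
  refine ⟨101, by norm_num, fun N hN hN3 ε hε hεN => ⟨⌈100 / ε ^ 2⌉₊, ?_, ?_⟩⟩
  · have hN3' : (3 : ℝ) ≤ N := by exact_mod_cast hN3
    have hε1 : ε ≤ 1 := by
      rw [lt_div_iff₀ (by positivity)] at hεN
      nlinarith
    have h1 : 1 ≤ 1 / ε ^ 2 := by
      rw [le_div_iff₀ (by positivity), one_mul]
      exact pow_le_one₀ hε.le hε1
    have h2 := (Nat.ceil_lt_add_one (a := 100 / ε ^ 2) (by positivity)).le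
    calc (⌈100 / ε ^ 2⌉₊ : ℝ) ≤ 100 / ε ^ 2 + 1 / ε ^ 2 := by linarith
      _ = 101 / ε ^ 2 := by ring
  · intro T hT ψ ρ hψ hρ
    have hT' : 100 / ε ^ 2 ≤ T := Nat.ceil_le.1 hT
    exact ⟨UniformCertification.le_verdictProb_certified hN hN3 hε hεN hT' hψ hρ,
      UniformCertification.le_verdictProb_failed hN hN3 hε hεN hT' hψ hρ⟩
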